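/- Let $2\ge\alpha_1\ge\alpha_2\ge\alpha_3>0$ be real numbers. For $\beta>0$ put $$ J_\beta=\iint_{\{(x,y)\in\mathbb{R}^3\times\mathbb{R}^3:\ |x|>1,\ |y|>1\}} \frac{dx\,dy}{\bigl(1+\sum_{j=1}^3|x_j+y_j|^{\beta}\bigr)\bigl(\sum_{j=1}^3|x_j|^{\alpha_j}\bigr)\bigl(\sum_{j=1}^3|y_j|^{\alpha_j}\bigr)}\in[0,\infty], $$ where $|x|$ denotes the Euclidean norm of $x\in\mathbb{R}^3$. If $2-\sum_{j=1}^3\frac1{\alpha_j}>0$, then $$ \inf\{\beta>0:\ J_\beta<\infty\}=4+\frac{\alpha_1}{\alpha_2}+\frac{\alpha_1}{\alpha_3}-2\alpha_1 . $$ If $2-\sum_{j=1}^3\frac1{\alpha_j}\le0$, then $J_\beta=\infty$ for every $\beta>0$. -/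

import Mathlib

open MeasureTheory
open scoped ENNReal

/-- Three-dimensional Euclidean space, with the Euclidean norm and Lebesgue measure. -/
abbrev E3 : Type := EuclideanSpace ℝ (Fin 3)

/-- The domain of integration `{(x, y) ∈ ℝ³ × ℝ³ : |x| > 1, |y| > 1}`. -/
def domainD : Set (E3 × E3) := {p | 1 < ‖p.1‖ ∧ 1 < ‖p.2‖}

/-- The integrand of `J_β`, with `α 0, α 1, α 2` standing for `α₁, α₂, α₃`. -/
noncomputable def integrandJ (α : Fin 3 → ℝ) (β : ℝ) (x y : E3) : ℝ :=
  1 / (1 + ∑ j, |x j + y j| ^ β) * (1 / ((∑ j, |x j| ^ α j) * ∑ j, |y j| ^ α j))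

/-- The integral `J_β`, as a value in `[0, ∞]`. -/
noncomputable def integralJ (α : Fin 3 → ℝ) (β : ℝ) : ℝ≥0∞ :=
  ∫⁻ p in domainD, ENNReal.ofReal (integrandJ α β p.1 p.2) ∂(volume : Measure (E3 × E3))

/-! Divergence (`integralJ_eq_top`): on boxes with `x_j` of size `R ^ (α 0 / α j)` and `|x_j + y_j|
≤ R ^ τ`, volume times the lower bound of the integrand is `R` to the power `∑ (α 0 / α j + τ) - τ β
- 2 α 0`, up to a constant. If this power is nonnegative, the disjoint boxes for dyadic `R` give an
infinite sum. Taking `τ = 1` gives the threshold, `τ = 0` the second claim.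

Convergence (`integralJ_lt_top`): each of the three factors dominates a product of powers of single
coordinates, so the integrand is bounded by a product of planar kernels, integrable for `s > 1`. The
exponents can be chosen for every `β` above the threshold. -/

/-- The map `(x, y) ↦ (j ↦ (x_j, y_j))`. -/
def coordPairs (p : E3 × E3) : Fin 3 → ℝ × ℝ := fun j => (p.1 j, p.2 j)

lemma measurePreserving_coordPairs : MeasurePreserving coordPairs := by
  have h1 : MeasurePreserving (Prod.map (@WithLp.ofLp 2 (Fin 3 → ℝ)) (@WithLp.ofLp 2 (Fin 3 → ℝ))) :=
    (PiLp.volume_preserving_ofLp (Fin 3)).prod (PiLp.volume_preserving_ofLp (Fin 3))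
  exact ((volume_measurePreserving_arrowProdEquivProdArrow ℝ ℝ (Fin 3)).symm _).comp h1

/-! ### Divergence -/

/-- The set of `(x, y)` with `A ≤ x < 2A` and `-L ≤ x + y ≤ 0`. -/
def strip (A L : ℝ) : Set (ℝ × ℝ) := {q | q.1 ∈ Set.Ico A (2 * A) ∧ q.1 + q.2 ∈ Set.Icc (-L) 0}

lemma measurableSet_strip (A L : ℝ) : MeasurableSet (strip A L) :=
  (measurableSet_Ico.preimage measurable_fst).inter
    (measurableSet_Icc.preimage (measurable_fst.add measurable_snd))

lemma volume_strip (A L : ℝ) : volume (strip A L) = ENNReal.ofReal A * ENNReal.ofReal L := by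
  have h := (measurePreserving_prod_add (volume : Measure ℝ) (volume : Measure ℝ)).measure_preimage
    (measurableSet_Ico.prod measurableSet_Icc : MeasurableSet
      (Set.Ico A (2 * A) ×ˢ Set.Icc (-L) 0)).nullMeasurableSet
  rw [Measure.prod_prod, Real.volume_Ico, Real.volume_Icc] at h
  calc volume (strip A L) = _ := h
    _ = _ := by congr 2 <;> ring

/-- The points whose coordinate pairs lie in the strips of width `R ^ τ` at height `R ^ (α₁ / αⱼ)`. -/
def stripBox (α : Fin 3 → ℝ) (τ R : ℝ) : Set (E3 × E3) :=
  coordPairs ⁻¹' Set.univ.pi fun j => strip (R ^ (α 0 / α j)) (R ^ τ)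

lemma measurableSet_stripBox (α : Fin 3 → ℝ) (τ R : ℝ) : MeasurableSet (stripBox α τ R) :=
  (MeasurableSet.univ_pi fun _ => measurableSet_strip _ _).preimage
    measurePreserving_coordPairs.measurable

lemma volume_stripBox (α : Fin 3 → ℝ) (τ : ℝ) {R : ℝ} (hR : 0 < R) :
    volume (stripBox α τ R) = ENNReal.ofReal (R ^ ∑ j, (α 0 / α j + τ)) := by
  rw [stripBox, measurePreserving_coordPairs.measure_preimage
    (MeasurableSet.univ_pi fun _ => measurableSet_strip _ _).nullMeasurableSet, volume_pi_pi,
    Real.rpow_sum_of_pos hR, ENNReal.ofReal_prod_of_nonneg fun _ _ => by positivity]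
  refine Finset.prod_congr rfl fun j _ => ?_
  rw [volume_strip, ← ENNReal.ofReal_mul (by positivity), Real.rpow_add hR]

lemma rpow_le_nine_mul {s a R e : ℝ} (hR : 0 ≤ R) (he : 0 < e) (he2 : e ≤ 2)
    (hs : |s| ≤ 3 * R ^ (a / e)) : |s| ^ e ≤ 9 * R ^ a := by
  calc |s| ^ e ≤ (3 * R ^ (a / e)) ^ e := Real.rpow_le_rpow (abs_nonneg _) hs he.le
    _ = 3 ^ e * R ^ a := by
      rw [Real.mul_rpow (by norm_num) (by positivity), ← Real.rpow_mul hR, div_mul_cancel₀ _ he.ne']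
    _ ≤ 3 ^ (2 : ℝ) * R ^ a := by
      gcongr
      norm_num
    _ = 9 * R ^ a := by norm_num

lemma mem_domainD_of_mem_stripBox {α : Fin 3 → ℝ} (hpos : ∀ j, 0 < α j) {τ R : ℝ} (hR : 2 ≤ R)
    {p : E3 × E3} (hp : p ∈ stripBox α τ R) : p ∈ domainD := by
  have h0 := hp 0 (Set.mem_univ _)
  simp only [strip, coordPairs, Set.mem_ofPred_eq, Set.mem_Ico, Set.mem_Icc,
    div_self (hpos 0).ne', Real.rpow_one] at h0
  obtain ⟨⟨h1, h2⟩, h3, h4⟩ := h0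
  have hx := PiLp.norm_apply_le p.1 0
  have hy := PiLp.norm_apply_le p.2 0
  rw [Real.norm_eq_abs] at hx hy
  have := le_abs_self (p.1 0)
  have := neg_le_abs (p.2 0)
  constructor <;> linarith

lemma le_integrandJ_of_mem_stripBox {α : Fin 3 → ℝ} (hpos : ∀ j, 0 < α j) (hle : ∀ j, α j ≤ α 0)
    (h2 : α 0 ≤ 2) {β τ R : ℝ} (hβ : 0 < β) (hτ0 : 0 ≤ τ) (hτ1 : τ ≤ 1) (hR : 2 ≤ R)
    {p : E3 × E3} (hp : p ∈ stripBox α τ R) :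
    1 / 2916 * R ^ (-(τ * β + 2 * α 0)) ≤ integrandJ α β p.1 p.2 := by
  have hR0 : 0 < R := by linarith
  have hb : ∀ j, |p.1 j| ≤ 3 * R ^ (α 0 / α j) ∧ |p.2 j| ≤ 3 * R ^ (α 0 / α j) ∧
      |p.1 j + p.2 j| ≤ R ^ τ ∧ 0 < p.1 j ∧ p.2 j < 0 := by
    intro j
    obtain ⟨⟨h3, h4⟩, h5, h6⟩ := hp j (Set.mem_univ _)
    simp only [coordPairs] at h3 h4 h5 h6
    have hA : 0 < R ^ (α 0 / α j) := by positivity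
    have hL : R ^ τ ≤ R ^ (α 0 / α j) := by
      apply Real.rpow_le_rpow_of_exponent_le (by linarith)
      exact hτ1.trans ((one_le_div (hpos j)).2 (hle j))
    refine ⟨abs_le.2 ⟨?_, ?_⟩, abs_le.2 ⟨?_, ?_⟩, abs_le.2 ⟨?_, ?_⟩, ?_, ?_⟩ <;> linarith
  have hQx : ∑ j, |p.1 j| ^ α j ≤ 27 * R ^ α 0 := by
    calc ∑ j, |p.1 j| ^ α j ≤ ∑ _j : Fin 3, 9 * R ^ α 0 := Finset.sum_le_sum fun j _ =>
          rpow_le_nine_mul hR0.le (hpos j) ((hle j).trans h2) (hb j).1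
      _ = _ := by simp; ring
  have hQy : ∑ j, |p.2 j| ^ α j ≤ 27 * R ^ α 0 := by
    calc ∑ j, |p.2 j| ^ α j ≤ ∑ _j : Fin 3, 9 * R ^ α 0 := Finset.sum_le_sum fun j _ =>
          rpow_le_nine_mul hR0.le (hpos j) ((hle j).trans h2) (hb j).2.1
      _ = _ := by simp; ring
  have hH : 1 + ∑ j, |p.1 j + p.2 j| ^ β ≤ 4 * R ^ (τ * β) := by
    have h1 : 1 ≤ R ^ (τ * β) := Real.one_le_rpow (by linarith) (by positivity)
    have : ∑ j, |p.1 j + p.2 j| ^ β ≤ ∑ _j : Fin 3, R ^ (τ * β) := by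
      refine Finset.sum_le_sum fun j _ => ?_
      rw [Real.rpow_mul hR0.le]
      exact Real.rpow_le_rpow (abs_nonneg _) (hb j).2.2.1 hβ.le
    simp at this
    linarith
  have hQx0 : 0 < ∑ j, |p.1 j| ^ α j := Finset.sum_pos
    (fun j _ => Real.rpow_pos_of_pos (abs_pos.2 (hb j).2.2.2.1.ne') _) Finset.univ_nonempty
  have hQy0 : 0 < ∑ j, |p.2 j| ^ α j := Finset.sum_pos
    (fun j _ => Real.rpow_pos_of_pos (abs_pos.2 (hb j).2.2.2.2.ne) _) Finset.univ_nonempty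
  have hH0 : 0 < 1 + ∑ j, |p.1 j + p.2 j| ^ β := by positivity
  calc 1 / 2916 * R ^ (-(τ * β + 2 * α 0))
      = 1 / (4 * R ^ (τ * β)) * (1 / ((27 * R ^ α 0) * (27 * R ^ α 0))) := by
        rw [Real.rpow_neg hR0.le, two_mul, Real.rpow_add hR0, Real.rpow_add hR0]
        field_simp
        norm_num
    _ ≤ _ := by
        rw [integrandJ]
        gcongr

lemma integralJ_eq_top {α : Fin 3 → ℝ} (hpos : ∀ j, 0 < α j) (hle : ∀ j, α j ≤ α 0)
    (h2 : α 0 ≤ 2) {β τ : ℝ} (hβ : 0 < β) (hτ0 : 0 ≤ τ) (hτ1 : τ ≤ 1)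
    (h : τ * β + 2 * α 0 ≤ ∑ j, (α 0 / α j + τ)) : integralJ α β = ∞ := by
  have hR : ∀ k : ℕ, (2 : ℝ) ≤ 2 ^ (k + 1) := fun k => by
    simpa using pow_le_pow_right₀ (one_le_two : (1 : ℝ) ≤ 2) (Nat.le_add_left 1 k)
  -- Coordinate `0` has height exponent `1`, so it lies in the dyadic interval `[R, 2R)`.
  have hdisj : Pairwise (Function.onFun Disjoint fun k : ℕ => stripBox α τ (2 ^ (k + 1))) := by
    refine (pairwise_disjoint_on _).2 fun m n hmn => Set.disjoint_left.2 fun p hm hn => ?_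
    have h1 := (hm 0 (Set.mem_univ _)).1.2
    have h3 := (hn 0 (Set.mem_univ _)).1.1
    simp only [div_self (hpos 0).ne', Real.rpow_one] at h1 h3
    have : (2 : ℝ) ^ (m + 1 + 1) ≤ 2 ^ (n + 1) :=
      pow_le_pow_right₀ one_le_two (by omega)
    rw [pow_succ] at this
    linarith
  have hterm : ∀ k : ℕ, ENNReal.ofReal (1 / 2916) ≤
      ∫⁻ p in stripBox α τ (2 ^ (k + 1)), ENNReal.ofReal (integrandJ α β p.1 p.2) := by
    intro k
    have hR0 : (0 : ℝ) < 2 ^ (k + 1) := by positivity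
    calc ENNReal.ofReal (1 / 2916)
        ≤ ENNReal.ofReal (1 / 2916 * (2 ^ (k + 1) : ℝ) ^ (-(τ * β + 2 * α 0))) *
            volume (stripBox α τ (2 ^ (k + 1))) := by
          rw [volume_stripBox α τ hR0, ← ENNReal.ofReal_mul (by positivity), mul_assoc,
            ← Real.rpow_add hR0]
          refine ENNReal.ofReal_le_ofReal (le_mul_of_one_le_right (by norm_num) ?_)
          exact Real.one_le_rpow (by linarith [hR k]) (by linarith)
      _ ≤ _ := by
          rw [← setLIntegral_const]
          exact setLIntegral_mono' (measurableSet_stripBox _ _ _) fun p hp =>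
            ENNReal.ofReal_le_ofReal
              (le_integrandJ_of_mem_stripBox hpos hle h2 hβ hτ0 hτ1 (hR k) hp)
  have hsub : (⋃ k : ℕ, stripBox α τ (2 ^ (k + 1))) ⊆ domainD :=
    Set.iUnion_subset fun k _ hp => mem_domainD_of_mem_stripBox hpos (hR k) hp
  refine top_le_iff.1 ?_
  calc ∞ = ∑' _ : ℕ, ENNReal.ofReal (1 / 2916) :=
        (ENNReal.tsum_const_eq_top_of_ne_zero (by norm_num)).symm
    _ ≤ ∑' k : ℕ, ∫⁻ p in stripBox α τ (2 ^ (k + 1)), ENNReal.ofReal (integrandJ α β p.1 p.2) :=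
        ENNReal.tsum_le_tsum hterm
    _ = ∫⁻ p in ⋃ k : ℕ, stripBox α τ (2 ^ (k + 1)), ENNReal.ofReal (integrandJ α β p.1 p.2) :=
        (lintegral_iUnion (fun k => measurableSet_stripBox _ _ _) hdisj _).symm
    _ ≤ integralJ α β := lintegral_mono_set hsub

/-! ### Convergence -/

/-- The planar majorant with exponents `s (1 - l)`, `s (1 - l)` and `2 s l` along the three
directions `x`, `y` and `x + y`. -/
noncomputable def kernel (s l : ℝ) (q : ℝ × ℝ) : ℝ :=
  (1 + |q.1|) ^ (-(s * (1 - l))) * (1 + |q.2|) ^ (-(s * (1 - l))) *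
    (1 + |q.1 + q.2|) ^ (-(2 * s * l))

lemma kernel_nonneg (s l : ℝ) (q : ℝ × ℝ) : 0 ≤ kernel s l q := by
  unfold kernel
  positivity

/-- Weighted AM-GM with weights `1 - 2l`, `l`, `l`, nonnegative because `l ≤ 1/2`. Each resulting
term involves only two of the three directions, so a volume-preserving linear change of variables
makes it a product. -/
lemma kernel_le {s l : ℝ} (hl0 : 0 ≤ l) (hl1 : l ≤ 1 / 2) (q : ℝ × ℝ) :
    kernel s l q ≤ (1 + |q.1|) ^ (-s) * (1 + |q.2|) ^ (-s) +
      (1 + |q.1|) ^ (-s) * (1 + |q.1 + q.2|) ^ (-s) +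
      (1 + |q.2|) ^ (-s) * (1 + |q.1 + q.2|) ^ (-s) := by
  have hA : 0 < 1 + |q.1| := by positivity
  have hB : 0 < 1 + |q.2| := by positivity
  have hC : 0 < 1 + |q.1 + q.2| := by positivity
  rw [kernel]
  generalize 1 + |q.1| = A at *
  generalize 1 + |q.2| = B at *
  generalize 1 + |q.1 + q.2| = C at *
  have h := Real.geom_mean_le_arith_mean3_weighted (w₁ := 1 - 2 * l) (w₂ := l) (w₃ := l)
    (p₁ := A ^ (-s) * B ^ (-s)) (p₂ := A ^ (-s) * C ^ (-s)) (p₃ := B ^ (-s) * C ^ (-s))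
    (by linarith) hl0 hl0 (by positivity) (by positivity) (by positivity) (by ring)
  calc A ^ (-(s * (1 - l))) * B ^ (-(s * (1 - l))) * C ^ (-(2 * s * l))
      = (A ^ (-s) * B ^ (-s)) ^ (1 - 2 * l) * (A ^ (-s) * C ^ (-s)) ^ l *
          (B ^ (-s) * C ^ (-s)) ^ l := by
        rw [Real.mul_rpow (by positivity) (by positivity), Real.mul_rpow (by positivity)
          (by positivity), Real.mul_rpow (by positivity) (by positivity)]
        simp only [← Real.rpow_mul hA.le, ← Real.rpow_mul hB.le, ← Real.rpow_mul hC.le]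
        rw [show -(s * (1 - l)) = -s * (1 - 2 * l) + -s * l by ring,
          show -(2 * s * l) = -s * l + -s * l by ring, Real.rpow_add hA, Real.rpow_add hB,
          Real.rpow_add hC]
        ring
    _ ≤ _ := h
    _ ≤ 1 * (A ^ (-s) * B ^ (-s)) + 1 * (A ^ (-s) * C ^ (-s)) + 1 * (B ^ (-s) * C ^ (-s)) := by
        gcongr <;> linarith
    _ = _ := by ring

lemma integrable_kernel {s l : ℝ} (hs : 1 < s) (hl0 : 0 ≤ l) (hl1 : l ≤ 1 / 2) :
    Integrable (kernel s l) := by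
  have h1 : Integrable fun x : ℝ => (1 + |x|) ^ (-s) := by
    simpa using integrable_one_add_norm (E := ℝ) (μ := volume) (r := s) (by simpa using hs)
  have hAB := h1.mul_prod h1
  have hAC := (measurePreserving_prod_add (volume : Measure ℝ) volume).integrable_comp_of_integrable
    hAB
  have hBC := (measurePreserving_prod_add_swap_right (volume : Measure ℝ)
    volume).integrable_comp_of_integrable hAB
  refine ((hAB.add hAC).add hBC).mono' ?_ (Filter.Eventually.of_forall fun q => ?_)
  · unfold kernel
    exact Measurable.aestronglyMeasurable (by fun_prop)
  · rw [Real.norm_of_nonneg (kernel_nonneg s l q)]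
    exact kernel_le hl0 hl1 q

/-- Multiply the bounds `u j ≤ M ^ (1 / e j)`; the total power of `M` is at most `1`, and `1 ≤ M`.
-/
lemma prod_rpow_le {ι : Type*} [Fintype ι] {u e p : ι → ℝ} {M : ℝ} (hM : 1 ≤ M)
    (hu : ∀ j, 1 ≤ u j) (he : ∀ j, 0 < e j) (hp : ∀ j, 0 ≤ p j) (hue : ∀ j, u j ^ e j ≤ M)
    (hsum : ∑ j, p j / e j ≤ 1) : ∏ j, u j ^ p j ≤ M := by
  have hM0 : 0 < M := by linarith
  calc ∏ j, u j ^ p j ≤ ∏ j, M ^ (p j / e j) := by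
        refine Finset.prod_le_prod (fun j _ => ?_) fun j _ => ?_
        · have := hu j
          positivity
        · have h0 : 0 ≤ u j := by linarith [hu j]
          calc u j ^ p j = (u j ^ e j) ^ (p j / e j) := by
                rw [← Real.rpow_mul h0, mul_div_cancel₀ _ (he j).ne']
            _ ≤ _ := Real.rpow_le_rpow (by positivity) (hue j) (div_nonneg (hp j) (he j).le)
    _ = M ^ ∑ j, p j / e j := (Real.rpow_sum_of_pos hM0 _ _).symm
    _ ≤ M ^ (1 : ℝ) := Real.rpow_le_rpow_of_exponent_le hM hsum
    _ = M := Real.rpow_one M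

lemma one_add_abs_rpow_le {t e M : ℝ} (he : 0 ≤ e) (hM : 1 ≤ M) (ht : |t| ^ e ≤ M) :
    (1 + |t|) ^ e ≤ 2 ^ e * M := by
  rcases le_total |t| 1 with h | h
  · calc (1 + |t|) ^ e ≤ 2 ^ e := Real.rpow_le_rpow (by positivity) (by linarith) he
      _ ≤ 2 ^ e * M := le_mul_of_one_le_right (by positivity) hM
  · calc (1 + |t|) ^ e ≤ (2 * |t|) ^ e := Real.rpow_le_rpow (by positivity) (by linarith) he
      _ = 2 ^ e * |t| ^ e := Real.mul_rpow (by norm_num) (abs_nonneg _)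
      _ ≤ _ := by gcongr

lemma exists_half_le_abs {x : E3} (hx : 1 < ‖x‖) : ∃ j, 1 / 2 ≤ |x j| := by
  by_contra! h
  have h1 : ‖x‖ ^ 2 = ∑ j, x j ^ 2 := by
    simp [EuclideanSpace.norm_sq_eq]
  have h2 : ∀ j, x j ^ 2 ≤ 1 / 4 := fun j => by
    rw [← sq_abs]
    nlinarith [h j, abs_nonneg (x j)]
  rw [Fin.sum_univ_three] at h1
  nlinarith [h2 0, h2 1, h2 2]

lemma prod_le_sum_rpow {α p : Fin 3 → ℝ} (hpos : ∀ j, 0 < α j) (h2 : ∀ j, α j ≤ 2)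
    (hp : ∀ j, 0 ≤ p j) (hsum : ∑ j, p j / α j ≤ 1) {x : E3} (hx : 1 < ‖x‖) :
    ∏ j, (1 + |x j|) ^ p j ≤ 16 * ∑ j, |x j| ^ α j := by
  have hterm : ∀ j, |x j| ^ α j ≤ ∑ j, |x j| ^ α j := fun j =>
    Finset.single_le_sum (f := fun j => |x j| ^ α j) (fun i _ => by positivity) (Finset.mem_univ j)
  -- Ensures that `M = 4 * ∑ j, |x j| ^ α j` is at least `1`; this is where `|x| > 1` enters.
  have hQ : 1 / 4 ≤ ∑ j, |x j| ^ α j := by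
    obtain ⟨j, hj⟩ := exists_half_le_abs hx
    calc (1 : ℝ) / 4 = (1 / 2) ^ (2 : ℝ) := by norm_num
      _ ≤ (1 / 2) ^ α j :=
        Real.rpow_le_rpow_of_exponent_ge (by norm_num) (by norm_num) (h2 j)
      _ ≤ |x j| ^ α j := Real.rpow_le_rpow (by norm_num) hj (hpos j).le
      _ ≤ _ := hterm j
  refine prod_rpow_le (by linarith) (fun j => by simp) hpos hp (fun j => ?_) hsum
  calc (1 + |x j|) ^ α j ≤ 2 ^ α j * (4 * ∑ j, |x j| ^ α j) :=
        one_add_abs_rpow_le (hpos j).le (by linarith) (by linarith [hterm j])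
    _ ≤ 2 ^ (2 : ℝ) * (4 * ∑ j, |x j| ^ α j) := by
        gcongr
        · norm_num
        · exact h2 j
    _ = _ := by norm_num; ring

lemma prod_le_one_add_sum_rpow {β : ℝ} {r : Fin 3 → ℝ} (hβ : 0 < β) (hr : ∀ j, 0 ≤ r j)
    (hsum : ∑ j, r j ≤ β) (z : Fin 3 → ℝ) :
    ∏ j, (1 + |z j|) ^ r j ≤ 2 ^ β * (1 + ∑ j, |z j| ^ β) := by
  have hterm : ∀ j, |z j| ^ β ≤ ∑ j, |z j| ^ β := fun j =>
    Finset.single_le_sum (f := fun j => |z j| ^ β) (fun i _ => by positivity) (Finset.mem_univ j)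
  have hH : 1 ≤ 1 + ∑ j, |z j| ^ β := by
    have : 0 ≤ ∑ j, |z j| ^ β := by positivity
    linarith
  refine prod_rpow_le (e := fun _ => β) ?_ (fun j => by simp) (fun _ => hβ) hr (fun j => ?_) ?_
  · exact one_le_mul_of_one_le_of_one_le (Real.one_le_rpow one_le_two hβ.le) hH
  · exact one_add_abs_rpow_le hβ.le hH (by linarith [hterm j])
  · rw [← Finset.sum_div]
    exact (div_le_one hβ).2 hsum

lemma integrandJ_le {α l : Fin 3 → ℝ} {β s : ℝ} (hpos : ∀ j, 0 < α j) (h2 : ∀ j, α j ≤ 2)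
    (hβ : 0 < β) (hs : 0 < s) (hl0 : ∀ j, 0 ≤ l j) (hl1 : ∀ j, l j ≤ 1 / 2)
    (hα : ∑ j, s * (1 - l j) / α j ≤ 1) (hlβ : ∑ j, 2 * s * l j ≤ β) {p : E3 × E3}
    (hp : p ∈ domainD) :
    integrandJ α β p.1 p.2 ≤ 2 ^ β * 256 * ∏ j, kernel s (l j) (coordPairs p j) := by
  have hp0 : ∀ j, 0 ≤ s * (1 - l j) := fun j => mul_nonneg hs.le (by linarith [hl1 j])
  have hX := prod_le_sum_rpow hpos h2 hp0 hα hp.1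
  have hY := prod_le_sum_rpow hpos h2 hp0 hα hp.2
  have hZ := prod_le_one_add_sum_rpow hβ (fun j => mul_nonneg (mul_nonneg two_pos.le hs.le) (hl0 j))
    hlβ fun j => p.1 j + p.2 j
  have hk : ∏ j, kernel s (l j) (coordPairs p j) =
      (∏ j, (1 + |p.1 j|) ^ (s * (1 - l j)))⁻¹ * (∏ j, (1 + |p.2 j|) ^ (s * (1 - l j)))⁻¹ *
        (∏ j, (1 + |p.1 j + p.2 j|) ^ (2 * s * l j))⁻¹ := by
    simp only [← Finset.prod_inv_distrib, ← Finset.prod_mul_distrib]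
    refine Finset.prod_congr rfl fun j _ => ?_
    simp only [kernel, coordPairs]
    rw [Real.rpow_neg (by positivity), Real.rpow_neg (by positivity), Real.rpow_neg (by positivity)]
  have hX0 : 0 < ∏ j, (1 + |p.1 j|) ^ (s * (1 - l j)) := Finset.prod_pos fun j _ => by positivity
  have hY0 : 0 < ∏ j, (1 + |p.2 j|) ^ (s * (1 - l j)) := Finset.prod_pos fun j _ => by positivity
  have hZ0 : 0 < ∏ j, (1 + |p.1 j + p.2 j|) ^ (2 * s * l j) :=
    Finset.prod_pos fun j _ => by positivity
  rw [hk, integrandJ]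
  generalize ∏ j, (1 + |p.1 j|) ^ (s * (1 - l j)) = X at *
  generalize ∏ j, (1 + |p.2 j|) ^ (s * (1 - l j)) = Y at *
  generalize ∏ j, (1 + |p.1 j + p.2 j|) ^ (2 * s * l j) = Z at *
  have h2β : (0 : ℝ) < 2 ^ β := by positivity
  calc _ ≤ 1 / (Z / 2 ^ β) * (1 / (X / 16 * (Y / 16))) := by
        gcongr
        · rwa [div_le_iff₀' h2β]
        · rwa [div_le_iff₀' (by norm_num)]
        · rwa [div_le_iff₀' (by norm_num)]
    _ = _ := by
        field_simp
        norm_num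

lemma integralJ_lt_top {α l : Fin 3 → ℝ} {β s : ℝ} (hpos : ∀ j, 0 < α j) (h2 : ∀ j, α j ≤ 2)
    (hβ : 0 < β) (hs : 1 < s) (hl0 : ∀ j, 0 ≤ l j) (hl1 : ∀ j, l j ≤ 1 / 2)
    (hα : ∑ j, s * (1 - l j) / α j ≤ 1) (hlβ : ∑ j, 2 * s * l j ≤ β) : integralJ α β < ∞ := by
  have hint : Integrable fun q : Fin 3 → ℝ × ℝ => 2 ^ β * 256 * ∏ j, kernel s (l j) (q j) :=
    (Integrable.fintype_prod (f := fun j => kernel s (l j))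
      fun j => integrable_kernel hs (hl0 j) (hl1 j)).const_mul _
  have hint' := measurePreserving_coordPairs.integrable_comp_of_integrable hint
  have hD : MeasurableSet domainD :=
    (measurableSet_lt measurable_const measurable_fst.norm).inter
      (measurableSet_lt measurable_const measurable_snd.norm)
  calc integralJ α β ≤ ∫⁻ p in domainD,
          ENNReal.ofReal (2 ^ β * 256 * ∏ j, kernel s (l j) (coordPairs p j)) :=
        setLIntegral_mono' hD fun p hp => ENNReal.ofReal_le_ofReal
          (integrandJ_le hpos h2 hβ (by linarith) hl0 hl1 hα hlβ hp)
    _ ≤ ∫⁻ p, ENNReal.ofReal (2 ^ β * 256 * ∏ j, kernel s (l j) (coordPairs p j)) :=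
        setLIntegral_le_lintegral _ _
    _ < ∞ := hint'.lintegral_lt_top

/-- The exponents needed for the product majorant exist above the threshold. -/
lemma exists_majorant_exponents {a b c β : ℝ} (ha2 : a ≤ 2) (hba : b ≤ a) (hcb : c ≤ b)
    (hc : 0 < c) (h : 0 < 2 - (1 / a + 1 / b + 1 / c)) (hβ : 4 + a / b + a / c - 2 * a < β) :
    ∃ l s : ℝ, 0 ≤ l ∧ l ≤ 1 / 2 ∧ 1 < s ∧
      s * ((1 - l) / a + 1 / 2 / b + 1 / 2 / c) ≤ 1 ∧ s * (2 * l + 2) ≤ β := by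
  have hb : 0 < b := by linarith
  have ha : 0 < a := by linarith
  have hab : 1 ≤ a / b := (one_le_div hb).2 hba
  have hac : 1 ≤ a / c := (one_le_div hc).2 (by linarith)
  -- At `s = 1` the first constraint is an equality for `l = m`, and `2 * m + 2` is the threshold.
  -- The strict gaps around `m` leave room for `s > 1`.
  set m : ℝ := 1 - a + a / b / 2 + a / c / 2 with hm
  have hm0 : 0 ≤ m := by linarith
  have hm1 : m < 1 / 2 := by
    have : 0 < a * (2 - (1 / a + 1 / b + 1 / c)) := mul_pos ha h
    have h3 : a * (2 - (1 / a + 1 / b + 1 / c)) = 2 * a - 1 - a / b - a / c := by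
      field_simp
      ring
    linarith
  obtain ⟨l, hml, hl⟩ := exists_between (lt_min hm1 (show m < (β - 2) / 2 by linarith))
  obtain ⟨hl1, hl2⟩ := lt_min_iff.1 hl
  have hE0 : 0 < (1 - l) / a + 1 / 2 / b + 1 / 2 / c := by
    have : 0 < 1 - l := by linarith
    positivity
  have hE1 : (1 - l) / a + 1 / 2 / b + 1 / 2 / c < 1 := by
    have h3 : (1 - l) / a + 1 / 2 / b + 1 / 2 / c = 1 - (l - m) / a := by
      rw [hm]
      field_simp
      ring
    have : 0 < (l - m) / a := div_pos (by linarith) ha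
    linarith
  have hl3 : 0 < 2 * l + 2 := by linarith
  refine ⟨l, min (1 / ((1 - l) / a + 1 / 2 / b + 1 / 2 / c)) (β / (2 * l + 2)), by linarith,
    hl1.le, lt_min ((one_lt_div hE0).2 hE1) ((one_lt_div hl3).2 (by linarith)), ?_, ?_⟩
  · rw [← le_div_iff₀ hE0]
    exact min_le_left _ _
  · rw [← le_div_iff₀ hl3]
    exact min_le_right _ _

theorem theorem8 (α : Fin 3 → ℝ) (h_le_two : α 0 ≤ 2) (h10 : α 1 ≤ α 0) (h21 : α 2 ≤ α 1)
    (h_pos : 0 < α 2) :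
    (0 < 2 - ∑ j, 1 / α j →
      IsGLB {β : ℝ | 0 < β ∧ integralJ α β < ∞}
        (4 + α 0 / α 1 + α 0 / α 2 - 2 * α 0)) ∧
    (2 - ∑ j, 1 / α j ≤ 0 → ∀ β : ℝ, 0 < β → integralJ α β = ∞) := by
  have hp1 : 0 < α 1 := h_pos.trans_le h21
  have hp0 : 0 < α 0 := hp1.trans_le h10
  have hpos : ∀ j, 0 < α j := by simp [Fin.forall_fin_succ, h_pos, hp1, hp0]
  have hle : ∀ j, α j ≤ α 0 := by simp [Fin.forall_fin_succ, h10, h21.trans h10]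
  have h2 : ∀ j, α j ≤ 2 := fun j => (hle j).trans h_le_two
  rw [Fin.sum_univ_three]
  refine ⟨fun hq => ⟨?_, ?_⟩, fun hq β hβ => ?_⟩
  · rintro β ⟨hβ, hfin⟩
    by_contra! hlt
    -- With `τ = 1` the exponent condition reads `β ≤ 4 + α 0 / α 1 + α 0 / α 2 - 2 * α 0`.
    refine hfin.ne (integralJ_eq_top hpos hle h_le_two hβ zero_le_one le_rfl ?_)
    rw [Fin.sum_univ_three, div_self hp0.ne']
    linarith
  · intro m hm
    by_contra! hlt
    obtain ⟨β, hγβ, hβm⟩ := exists_between hlt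
    have hab : 1 ≤ α 0 / α 1 := (one_le_div hp1).2 h10
    have hac : 1 ≤ α 0 / α 2 := (one_le_div h_pos).2 (hle 2)
    have hβ : 0 < β := by linarith
    obtain ⟨l, s, hl0, hl1, hs, hα, hlβ⟩ :=
      exists_majorant_exponents h_le_two h10 h21 h_pos hq hγβ
    have hfin : integralJ α β < ∞ := by
      -- Raising `l j` relaxes the `α` constraint by `s / α j` per unit, at the same cost in `β` for
      -- every `j`. Hence the smaller exponents `α 1`, `α 2` get the maximal `1/2`.
      refine integralJ_lt_top (l := ![l, 1 / 2, 1 / 2]) hpos h2 hβ hs ?_ ?_ ?_ ?_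
      · simp [Fin.forall_fin_succ, hl0]
      · simpa [Fin.forall_fin_succ] using hl1
      · rw [Fin.sum_univ_three]
        refine le_trans (le_of_eq ?_) hα
        simp
        ring
      · rw [Fin.sum_univ_three]
        refine le_trans (le_of_eq ?_) hlβ
        simp
        ring
    exact (hm ⟨hβ, hfin⟩).not_gt hβm
  -- With `τ = 0` the exponent condition no longer involves `β`.
  · refine integralJ_eq_top hpos hle h_le_two hβ le_rfl zero_le_one ?_
    have h3 : 0 ≤ α 0 * (1 / α 0 + 1 / α 1 + 1 / α 2 - 2) := mul_nonneg hp0.le (by linarith)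
    rw [Fin.sum_univ_three]
    have h4 : α 0 * (1 / α 0 + 1 / α 1 + 1 / α 2 - 2) =
        α 0 / α 0 + α 0 / α 1 + α 0 / α 2 - 2 * α 0 := by ring
    linarith
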